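/- Conventions. Rows and columns of an $m\times n$ array are indexed by $0,\dots,m-1$ and $0,\dots,n-1$. For positive integers $m,n$, an $m\times n$ Ferrers diagram $\mathcal F$ is an $m\times n$ array of dots and empty cells in which all dots are shifted to the right, each row has at most as many dots as the previous row, the first row has $n$ dots and the rightmost column has $m$ dots; $\gamma_i$ ($0\le i\le n-1$) denotes the number of dots in the $i$-th column. For a prime power $q$, an $[\mathcal F,k,\delta]_q$ Ferrers diagram rank-metric (FDRM) code is a $k$-dimensional $\mathbb F_q$-linear subspace $\mathcal C$ of $\mathbb F_q^{m\times n}$ all of whose matrices are zero at every cell not in $\mathcal F$, and whose minimum rank distance $\min\{\operatorname{rank}(A-B): A,B\in\mathcal C,\ A\ne B\}$ equals $\delta$. It is called optimal if $k=\min_{0\le i\le\delta-1}v_i$, where $v_i$ is the number of dots of $\mathcal F$ that are contained neither in the first $i$ rows nor in the rightmost $\delta-1-i$ columns. Theorem. Let $\delta$, $n$ and $r$ be positive integers with $r+1\le\delta\le n-r$. Let $\mathcal F$ be an $m\times n$ Ferrers diagram such that (1) $\gamma_{n-r-1}\le n-r$; (2) $\gamma_{n-r+i}\ge n-r+\sum_{j=0}^{i}\gamma_j$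 for $0\le i\le r-1$; (3) $\gamma_i\ge n-r$ for $n-\delta+1\le i\le n-1$. Then for every prime power $q$ there exists an optimal $[\mathcal F,\sum_{i=0}^{n-\delta}\gamma_i,\delta]_q$ FDRM code. -/

import Mathlib

/-- An `m × n` Ferrers diagram, for positive `m` and `n`, given by its set of dots. Rows and columns
are indexed from `0`, row `0` being the top row. All dots are shifted to the right and to the top,
the first row has `n` dots and the rightmost column has `m` dots. -/
structure FerrersDiagram (m n : ℕ) where
  /-- the set of dots -/
  cells : Finset (Fin m × Fin n)
  m_pos : 0 < m
  n_pos : 0 < n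
  right_mem : ∀ (i : Fin m) (j j' : Fin n), (i, j) ∈ cells → j ≤ j' → (i, j') ∈ cells
  up_mem : ∀ (i i' : Fin m) (j : Fin n), (i, j) ∈ cells → i' ≤ i → (i', j) ∈ cells
  first_row : ∀ (i : Fin m) (j : Fin n), (i : ℕ) = 0 → (i, j) ∈ cells
  last_col : ∀ (i : Fin m) (j : Fin n), (j : ℕ) + 1 = n → (i, j) ∈ cells

namespace FerrersDiagram

variable {m n : ℕ}

/-- `F.γ j` is the number of dots in the column with index `j` (meaningful for `j < n`). -/
def γ (F : FerrersDiagram m n) (j : ℕ) : ℕ :=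
  (F.cells.filter (fun c => (c.2 : ℕ) = j)).card

/-- `F.v δ i`, for `i < δ`, is the number of dots which are neither in the first `i` rows nor in the
rightmost `δ - 1 - i` columns. -/
def v (F : FerrersDiagram m n) (δ i : ℕ) : ℕ :=
  (F.cells.filter (fun c => i ≤ (c.1 : ℕ) ∧ (c.2 : ℕ) + (δ - 1 - i) < n)).card

end FerrersDiagram

/-- The rank distance on matrices. -/
noncomputable def rankDist {m n : ℕ} {K : Type*} [Field K]
    (A B : Matrix (Fin m) (Fin n) K) : ℕ :=
  (A - B).rank

/-- `C` is an `[m × n, k, δ]` rank-metric code over `K`: a `k`-dimensional linear subspace whose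
minimum rank distance exists and is exactly `δ`. -/
def IsRankMetricCode {m n : ℕ} {K : Type*} [Field K]
    (C : Submodule K (Matrix (Fin m) (Fin n) K)) (k δ : ℕ) : Prop :=
  Module.finrank K C = k ∧
    IsLeast {d : ℕ | ∃ A ∈ C, ∃ B ∈ C, A ≠ B ∧ rankDist A B = d} δ

/-- `C` is an `[F, k, δ]` Ferrers diagram rank-metric code over `K`: a rank-metric code all of whose
matrices vanish outside of `F`. -/
def IsFDRMCode {m n : ℕ} (F : FerrersDiagram m n) {K : Type*} [Field K]
    (C : Submodule K (Matrix (Fin m) (Fin n) K)) (k δ : ℕ) : Prop :=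
  IsRankMetricCode C k δ ∧
    ∀ A ∈ C, ∀ (i : Fin m) (j : Fin n), (i, j) ∉ F.cells → A i j = 0

/-- An optimal `[F, k, δ]` code: its dimension attains the Singleton-like bound
`k ≤ min {v 0, …, v (δ - 1)}`. -/
def IsOptimalFDRMCode {m n : ℕ} (F : FerrersDiagram m n) {K : Type*} [Field K]
    (C : Submodule K (Matrix (Fin m) (Fin n) K)) (k δ : ℕ) : Prop :=
  IsFDRMCode F C k δ ∧ IsLeast {w : ℕ | ∃ i < δ, F.v δ i = w} k

/-! ### Linearized polynomials and nested Gabidulin codes. -/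

section QPolynomials

variable (K : Type*) [Field K] [Finite K] {L : Type*} [Field L] [Algebra K L]

/-! Put `μ = n - r` and `k = n - δ + 1`, and let `L` be the extension of `K` of degree `μ`. A
message `w` fills the dots of the first `k` columns freely. Those columns have at most `μ` dots, so
each is an element of `L`. The top `μ` rows of the codeword encode these `k` elements by a
systematic `k × n` matrix `c` over `L`; below them, the column `μ + l` repeats the message columns
`l, l - 1, …, 0`, stacked.

Ordinary Gabidulin codes over `L` have length at most `μ`, while here `n = μ + r`. The matrix `c` is
therefore only required to be Gabidulin on windows: for each `l ≤ r`, rows `l, …, k - 1` generate a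
Gabidulin code on columns `l, …, l + μ - 1` (`exists_systematic_gabidulin_windows`). The windows are
compatible because the subcode vanishing at the first evaluation point is again Gabidulin, with
points transformed by `x ↦ x ^ q - c x`.

For a nonzero message let `i` be its first nonzero column, or `r` if that is smaller. The stacked
blocks put the columns `μ + i, …, n - 1` in echelon form, so a kernel vector vanishes there
(`stackEntry_pivot`). Its coordinates in the window of `i` lie in a space of dimension less than `k
- i`, and the first `i` coordinates add at most `i`. So the kernel has dimension less than `k`, and
the rank is at least `n - k + 1 = δ` (`finrank_ker_codeEntry_lt`). The dimension of the code is `v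
0`, and the Singleton-like bound makes this the minimum of the `v i`. -/

theorem exists_algHom_pow_card_pow (s : ℕ) :
    ∃ φ : L →ₐ[K] L, ∀ x, φ x = x ^ (Nat.card K ^ s) := by
  have := Fintype.ofFinite K
  refine ⟨FiniteField.frobeniusAlgHom K L ^ s, fun x => ?_⟩
  rw [AlgHom.coe_pow, FiniteField.coe_frobeniusAlgHom, pow_iterate, Nat.card_eq_fintype_card]

/-- The `q`-polynomial `∑ s < d, a s * x ^ (q ^ s)`, where `q` is the cardinality of `K`, as a
`K`-linear map. -/
noncomputable def qPoly (d : ℕ) (a : ℕ → L) : L →ₗ[K] L where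
  toFun x := ∑ s ∈ Finset.range d, a s * x ^ (Nat.card K ^ s)
  map_add' x y := by
    rw [← Finset.sum_add_distrib]
    refine Finset.sum_congr rfl fun s _ => ?_
    obtain ⟨φ, hφ⟩ := exists_algHom_pow_card_pow K (L := L) s
    rw [← hφ, map_add, mul_add, hφ, hφ]
  map_smul' c x := by
    simp only [RingHom.id_apply, Finset.smul_sum]
    refine Finset.sum_congr rfl fun s _ => ?_
    obtain ⟨φ, hφ⟩ := exists_algHom_pow_card_pow K (L := L) s
    rw [← hφ, map_smul, mul_smul_comm, hφ]

theorem qPoly_apply (d : ℕ) (a : ℕ → L) (x : L) :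
    qPoly K d a x = ∑ s ∈ Finset.range d, a s * x ^ (Nat.card K ^ s) := rfl

/-- Since `x ↦ x ^ q` is additive, the coefficient at `s` is `a (s - 1) - a s * c ^ (q ^ s)`. This
carries rows of one window back to the preceding, larger code. -/
theorem exists_qPoly_comp (d : ℕ) (a : ℕ → L) (c : L) :
    ∃ a' : ℕ → L, ∀ x, qPoly K (d + 1) a' x = qPoly K d a (x ^ Nat.card K - c * x) := by
  refine ⟨fun s => (if s = 0 then 0 else a (s - 1)) -
    (if s < d then a s * c ^ (Nat.card K ^ s) else 0), fun x => ?_⟩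
  have hsub : ∀ s, (x ^ Nat.card K - c * x) ^ (Nat.card K ^ s) =
      x ^ (Nat.card K ^ (s + 1)) - c ^ (Nat.card K ^ s) * x ^ (Nat.card K ^ s) := by
    intro s
    obtain ⟨φ, hφ⟩ := exists_algHom_pow_card_pow K (L := L) s
    rw [← hφ, map_sub, hφ, hφ, mul_pow, ← pow_mul, pow_succ']
  simp only [qPoly_apply, hsub, sub_mul, mul_sub, Finset.sum_sub_distrib]
  congr 1
  · rw [Finset.sum_range_succ']
    simp
  · rw [Finset.sum_range_succ]
    simp only [lt_irrefl, if_false, zero_mul, add_zero]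
    refine Finset.sum_congr rfl fun s hs => ?_
    rw [if_pos (Finset.mem_range.1 hs), mul_assoc]

variable [FiniteDimensional K L]

/-- The polynomial has degree at most `q ^ (d - 1)`, which bounds the number of its roots, whereas
the kernel has `q ^ dim` elements. -/
theorem finrank_ker_qPoly_lt {d : ℕ} {a : ℕ → L} (ha : ∃ s < d, a s ≠ 0) :
    Module.finrank K (LinearMap.ker (qPoly K d a)) < d := by
  classical
  obtain ⟨s, hs, has⟩ := ha
  have hq : 1 < Nat.card K := Finite.one_lt_card
  set P : Polynomial L := ∑ s ∈ Finset.range d, Polynomial.monomial (Nat.card K ^ s) (a s) with hP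
  have hP0 : P ≠ 0 := by
    intro h
    have := congrArg (fun p => Polynomial.coeff p (Nat.card K ^ s)) h
    simp only [hP, Polynomial.finsetSum_coeff, Polynomial.coeff_monomial,
      Polynomial.coeff_zero, (Nat.pow_right_injective hq).eq_iff] at this
    rw [Finset.sum_ite_eq' (Finset.range d) s a, if_pos (Finset.mem_range.2 hs)] at this
    exact has this
  have hdeg : P.natDegree ≤ Nat.card K ^ (d - 1) := by
    refine Polynomial.natDegree_sum_le_of_forall_le _ _ fun t ht => ?_
    exact (Polynomial.natDegree_monomial_le _).trans
      (Nat.pow_le_pow_right hq.le (by have := Finset.mem_range.1 ht; omega))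
  have hsub : (LinearMap.ker (qPoly K d a) : Set L) ⊆ (P.roots.toFinset : Set L) := by
    intro x hx
    have hx : qPoly K d a x = 0 := hx
    rw [Finset.mem_coe, Multiset.mem_toFinset, Polynomial.mem_roots hP0, Polynomial.IsRoot.def,
      hP, Polynomial.eval_finsetSum]
    simp only [Polynomial.eval_monomial]
    exact hx
  have hcard : Nat.card (LinearMap.ker (qPoly K d a)) ≤ Nat.card K ^ (d - 1) := by
    calc Nat.card (LinearMap.ker (qPoly K d a))
        = (LinearMap.ker (qPoly K d a) : Set L).ncard := rfl
      _ ≤ (P.roots.toFinset : Set L).ncard := Set.ncard_le_ncard hsub (Finset.finite_toSet _)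
      _ = P.roots.toFinset.card := Set.ncard_coe_finset _
      _ ≤ P.natDegree := (Multiset.toFinset_card_le _).trans (Polynomial.card_roots' P)
      _ ≤ _ := hdeg
  rw [Module.natCard_eq_pow_finrank (K := K)] at hcard
  have := (Nat.pow_le_pow_iff_right hq).1 hcard
  omega

theorem qPoly_eq_zero_of_linearIndepOn {d i : ℕ} {a : ℕ → L} {g : ℕ → L}
    (hg : LinearIndepOn K g (Set.Ico i (i + d)))
    (h : ∀ t ∈ Set.Ico i (i + d), qPoly K d a (g t) = 0) : ∀ s < d, a s = 0 := by
  by_contra! hne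
  have hlt := finrank_ker_qPoly_lt K hne
  have hle : Submodule.span K (g '' Set.Ico i (i + d)) ≤ LinearMap.ker (qPoly K d a) := by
    rw [Submodule.span_le]
    rintro _ ⟨t, ht, rfl⟩
    exact h t ht
  have h1 := Submodule.finrank_mono hle
  rw [Set.image_eq_range] at h1
  have h2 := finrank_span_eq_card (R := K) hg
  simp at h2
  omega

theorem exists_qPoly_interpolation {d i : ℕ} {g : ℕ → L}
    (hg : LinearIndepOn K g (Set.Ico i (i + d))) (y : ℕ → L) :
    ∃ a : ℕ → L, ∀ t ∈ Set.Ico i (i + d), qPoly K d a (g t) = y t := by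
  -- The Moore matrix of the `d` points: a square system, so injectivity gives solvability.
  let E : (Fin d → L) →ₗ[L] (Fin d → L) :=
    { toFun := fun a t => ∑ s : Fin d, a s * (g (i + t)) ^ (Nat.card K ^ (s : ℕ))
      map_add' := fun a b => by ext t; simp [add_mul, Finset.sum_add_distrib]
      map_smul' := fun c a => by ext t; simp [Finset.mul_sum, mul_assoc] }
  have hE : ∀ (a : Fin d → L) (t : Fin d), E a t =
      qPoly K d (fun s => if h : s < d then a ⟨s, h⟩ else 0) (g (i + t)) := by
    intro a t
    rw [qPoly_apply, Finset.sum_range]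
    simp [E]
  have hinj : Function.Injective E := by
    rw [← LinearMap.ker_eq_bot, LinearMap.ker_eq_bot']
    intro a ha
    have := qPoly_eq_zero_of_linearIndepOn K hg
      (a := fun s => if h : s < d then a ⟨s, h⟩ else 0) (fun t ht => by
        have h1 := hE a ⟨t - i, by have := ht.1; have := ht.2; omega⟩
        have h2 : i + (t - i) = t := by have := ht.1; omega
        simp only [h2, ha] at h1
        exact h1.symm)
    ext s
    simpa using this s s.2
  obtain ⟨a, ha⟩ := (LinearMap.injective_iff_surjective.1 hinj) (fun t => y (i + t))
  refine ⟨fun s => if h : s < d then a ⟨s, h⟩ else 0, fun t ht => ?_⟩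
  have h1 := hE a ⟨t - i, by have := ht.1; have := ht.2; omega⟩
  have h2 : i + (t - i) = t := by have := ht.1; omega
  simp only [h2, ha] at h1
  exact h1.symm

/-- With `c = (g i) ^ (q - 1)`, the kernel of `x ↦ x ^ q - c x` is exactly the line `K · g i`. The
other points thus keep independent images, spanning a hyperplane; any element outside it serves as
the point for the new column `i + μ`. -/
theorem exists_linearIndepOn_frobenius_sub {i μ : ℕ} (hμ : Module.finrank K L = μ) (hμ0 : 0 < μ)
    {g : ℕ → L} (hg : LinearIndepOn K g (Set.Ico i (i + μ))) :
    ∃ (c : L) (g' : ℕ → L), LinearIndepOn K g' (Set.Ico (i + 1) (i + 1 + μ)) ∧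
      (g i) ^ Nat.card K - c * g i = 0 ∧
      ∀ t ∈ Set.Ico (i + 1) (i + μ), g' t = (g t) ^ Nat.card K - c * g t := by
  classical
  have hgi : g i ≠ 0 := hg.ne_zero (Set.mem_Ico.2 ⟨le_rfl, by omega⟩)
  have hq : 1 < Nat.card K := Finite.one_lt_card
  set c : L := (g i) ^ (Nat.card K - 1) with hc
  set a : ℕ → L := fun s => if s = 0 then -c else 1 with ha
  have hφ : ∀ x, qPoly K 2 a x = x ^ Nat.card K - c * x := by
    intro x
    simp [qPoly_apply, Finset.sum_range_succ, ha]
    ring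
  have hgi0 : (g i) ^ Nat.card K - c * g i = 0 := by
    rw [hc, ← pow_succ, Nat.sub_add_cancel hq.le, sub_self]
  have hker : LinearMap.ker (qPoly K 2 a) = Submodule.span K {g i} := by
    symm
    apply Submodule.eq_of_le_of_finrank_le
    · rw [Submodule.span_singleton_le_iff_mem, LinearMap.mem_ker, hφ, hgi0]
    · rw [finrank_span_singleton hgi]
      have := finrank_ker_qPoly_lt K (d := 2) (a := a) ⟨1, by norm_num, by simp [ha]⟩
      omega
  have hins : Set.Ico i (i + μ) = insert i (Set.Ico (i + 1) (i + μ)) := by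
    ext t; simp; omega
  have hg1 : LinearIndepOn K g (Set.Ico (i + 1) (i + μ)) :=
    hg.mono (by rw [hins]; exact Set.subset_insert _ _)
  have hnot : g i ∉ Submodule.span K (g '' Set.Ico (i + 1) (i + μ)) := by
    rw [hins] at hg
    exact ((linearIndepOn_insert (by simp)).1 hg).2
  have hφg : LinearIndepOn K (fun t => qPoly K 2 a (g t)) (Set.Ico (i + 1) (i + μ)) := by
    refine LinearIndependent.map (v := fun t : Set.Ico (i + 1) (i + μ) => g t) hg1 ?_
    rw [hker, ← Set.image_eq_range, disjoint_comm]
    exact (Submodule.disjoint_span_singleton' hgi).2 hnot |>.symm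
  have hproper : Submodule.span K ((fun t => qPoly K 2 a (g t)) '' Set.Ico (i + 1) (i + μ)) ≠ ⊤ := by
    intro h
    have h2 := finrank_span_eq_card (R := K) hφg
    rw [Set.image_eq_range] at h
    rw [h, finrank_top, hμ] at h2
    simp at h2
    omega
  obtain ⟨y, -, hy⟩ := SetLike.exists_of_lt (lt_top_iff_ne_top.2 hproper)
  set g' : ℕ → L := fun t => if t = i + μ then y else qPoly K 2 a (g t) with hg'
  have heq : Set.EqOn (fun t => qPoly K 2 a (g t)) g' (Set.Ico (i + 1) (i + μ)) := by
    intro t ht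
    have : t ≠ i + μ := ht.2.ne
    simp [hg', this]
  refine ⟨c, g', ?_, hgi0, fun t ht => ?_⟩
  · have hins' : Set.Ico (i + 1) (i + 1 + μ) = insert (i + μ) (Set.Ico (i + 1) (i + μ)) := by
      ext t; simp; omega
    rw [hins']
    refine (hφg.congr heq).insert ?_
    rw [← heq.image_eq]
    simpa [hg'] using hy
  · rw [← heq ht, ← hφ]

/-- A systematic matrix whose windows `[j, k) × [j, j + μ)`, for `i ≤ j ≤ i + r`, generate
Gabidulin codes of length `μ`. -/
theorem exists_systematic_gabidulin_windows {μ k : ℕ} (hμ : Module.finrank K L = μ) (hμ0 : 0 < μ) :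
    ∀ (r i : ℕ), i + r ≤ k → k ≤ i + μ → ∀ g : ℕ → L, LinearIndepOn K g (Set.Ico i (i + μ)) →
    ∃ c : ℕ → ℕ → L, (∀ j ∈ Set.Ico i k, ∀ t < k, c j t = if j = t then 1 else 0) ∧
      (∀ j ∈ Set.Ico i k, ∃ a, ∀ t ∈ Set.Ico i (i + μ), c j t = qPoly K (k - i) a (g t)) ∧
      ∀ l ∈ Set.Icc i (i + r), ∃ h : ℕ → L, LinearIndepOn K h (Set.Ico l (l + μ)) ∧
        ∀ j ∈ Set.Ico l k, ∃ a, ∀ t ∈ Set.Ico l (l + μ), c j t = qPoly K (k - l) a (h t) := by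
  classical
  intro r
  induction r with
  | zero =>
    intro i hik hkμ g hg
    have hg' : LinearIndepOn K g (Set.Ico i (i + (k - i))) := hg.mono (by
      intro t; simp; omega)
    choose a ha using fun j : ℕ =>
      exists_qPoly_interpolation K hg' (fun t => if j = t then 1 else 0)
    set c : ℕ → ℕ → L := fun j t => if t < k then (if j = t then 1 else 0)
      else qPoly K (k - i) (a j) (g t) with hc
    have hca : ∀ j ∈ Set.Ico i k, ∀ t ∈ Set.Ico i (i + μ),
        c j t = qPoly K (k - i) (a j) (g t) := by
      intro j hj t ht
      simp only [hc]
      split_ifs with h1 h2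
      · rw [ha j t ⟨ht.1, by have := ht.1; omega⟩]
        simp [h2]
      · rw [ha j t ⟨ht.1, by have := ht.1; omega⟩]
        simp [h2]
      · rfl
    refine ⟨c, fun j hj t ht => by simp [hc, ht], fun j hj => ⟨a j, hca j hj⟩, fun l hl => ?_⟩
    obtain rfl : l = i := by have := hl.1; have := hl.2; omega
    exact ⟨g, hg, fun j hj => ⟨a j, hca j hj⟩⟩
  | succ r ih =>
    intro i hik hkμ g hg
    obtain ⟨e, g', hg', hei, he⟩ := exists_linearIndepOn_frobenius_sub K hμ hμ0 hg
    obtain ⟨c', hsys, hwin, hall⟩ := ih (i + 1) (by omega) (by omega) g' hg'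
    have hg0 : LinearIndepOn K g (Set.Ico i (i + (k - i))) := hg.mono (by
      intro t; simp; omega)
    obtain ⟨b, hb⟩ := exists_qPoly_interpolation K hg0 (fun t => if i = t then 1 else 0)
    -- Only row `i` is new, interpolated to be systematic on columns `i, …, k - 1`. Its entries from
    -- column `i + μ` on are irrelevant: later windows do not contain row `i`.
    set c : ℕ → ℕ → L := fun j t => if j = i then
      (if t < k then (if j = t then 1 else 0) else qPoly K (k - i) b (g t)) else c' j t with hc
    have hrow : ∀ j ∈ Set.Ico i k, ∃ a, ∀ t ∈ Set.Ico i (i + μ),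
        c j t = qPoly K (k - i) a (g t) := by
      intro j hj
      by_cases hji : j = i
      · subst hji
        refine ⟨b, fun t ht => ?_⟩
        simp only [hc, if_true]
        split_ifs with h1 h2
        · rw [hb t ⟨ht.1, by have := ht.1; omega⟩]
          simp [h2]
        · rw [hb t ⟨ht.1, by have := ht.1; omega⟩]
          simp [h2]
        · rfl
      · have hj' : j ∈ Set.Ico (i + 1) k := ⟨by have := hj.1; omega, hj.2⟩
        obtain ⟨a, ha⟩ := hwin j hj'
        obtain ⟨a', ha'⟩ := exists_qPoly_comp K (k - (i + 1)) a e
        have hki : k - (i + 1) + 1 = k - i := by omega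
        rw [hki] at ha'
        refine ⟨a', fun t ht => ?_⟩
        simp only [hc, if_neg hji, ha']
        -- At column `i` a lower row is zero by systematicity, and the composed polynomial is zero
        -- because `g i` is killed.
        by_cases hti : t = i
        · subst hti
          rw [hei, map_zero, hsys j hj' t (by omega), if_neg hji]
        · have ht1 : t ∈ Set.Ico (i + 1) (i + μ) := ⟨by have := ht.1; omega, ht.2⟩
          rw [← he t ht1]
          exact ha t ⟨ht1.1, by have := ht1.2; omega⟩
    refine ⟨c, fun j hj t ht => ?_, hrow, fun l hl => ?_⟩
    · by_cases hji : j = i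
      · simp [hc, hji, ht]
      · simp only [hc, if_neg hji]
        exact hsys j ⟨by have := hj.1; omega, hj.2⟩ t ht
    · by_cases hli : l = i
      · subst hli
        exact ⟨g, hg, hrow⟩
      · obtain ⟨h, hh, hh'⟩ := hall l ⟨by have := hl.1; omega, by have := hl.2; omega⟩
        refine ⟨h, hh, fun j hj => ?_⟩
        have hji : j ≠ i := by have := hl.1; have := hj.1; omega
        simpa only [hc, if_neg hji] using hh' j hj

/-- Every nonzero combination of the rows of a window is the evaluation of a `K`-linear map with
small kernel. -/
theorem exists_systematic_windows {μ k r : ℕ} (hμ : Module.finrank K L = μ) (hμ0 : 0 < μ)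
    (hrk : r ≤ k) (hkμ : k ≤ μ) :
    ∃ c : ℕ → ℕ → L, (∀ j < k, ∀ t < k, c j t = if j = t then 1 else 0) ∧
      ∀ l ≤ r, ∃ h : ℕ → L, LinearIndepOn K h (Set.Ico l (l + μ)) ∧
        ∀ u : ℕ → L, (∃ j ∈ Set.Ico l k, u j ≠ 0) → ∃ f : L →ₗ[K] L,
          Module.finrank K (LinearMap.ker f) < k - l ∧
          ∀ t ∈ Set.Ico l (l + μ), ∑ j ∈ Finset.Ico l k, u j * c j t = f (h t) := by
  classical
  let b := Module.finBasisOfFinrankEq K L hμ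
  have hg : LinearIndepOn K (fun t : ℕ => if ht : t < μ then b ⟨t, ht⟩ else 0)
      (Set.Ico 0 (0 + μ)) := by
    have := b.linearIndependent.comp (fun t : Set.Ico 0 (0 + μ) => (⟨t, by simpa using t.2⟩ : Fin μ))
      (fun s t hst => by simpa [Subtype.ext_iff] using hst)
    change LinearIndependent K (fun t : Set.Ico 0 (0 + μ) => _)
    convert this using 1
    ext t
    have : (t : ℕ) < μ := by simpa using t.2
    simp [this]
  obtain ⟨c, hsys, -, hall⟩ := exists_systematic_gabidulin_windows K (k := k) hμ hμ0 r 0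
    (by omega) (by omega) _ hg
  refine ⟨c, fun j hj => hsys j ⟨j.zero_le, hj⟩, fun l hl => ?_⟩
  obtain ⟨h, hh, hrow⟩ := hall l ⟨l.zero_le, by omega⟩
  refine ⟨h, hh, fun u ⟨j₀, hj₀, hu⟩ => ?_⟩
  choose! a ha using hrow
  have key : ∀ t ∈ Set.Ico l (l + μ), ∑ j ∈ Finset.Ico l k, u j * c j t =
      qPoly K (k - l) (fun s => ∑ j ∈ Finset.Ico l k, u j * a j s) (h t) := by
    intro t ht
    simp only [qPoly_apply, Finset.sum_mul]
    rw [Finset.sum_comm]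
    refine Finset.sum_congr rfl fun j hj => ?_
    rw [ha j (by simpa using hj) t ht, qPoly_apply, Finset.mul_sum]
    simp only [mul_assoc]
  refine ⟨_, finrank_ker_qPoly_lt K ?_, key⟩
  by_contra! hz
  refine hu ?_
  -- By systematicity the combination has entry `u j₀` in column `j₀`, so the zero polynomial would
  -- force `u j₀ = 0`.
  have h1 := key j₀ ⟨hj₀.1, by have := hj₀.2; omega⟩
  rw [qPoly_apply, Finset.sum_eq_zero (s := Finset.range (k - l)) (fun s hs => by
    rw [hz s (Finset.mem_range.1 hs), zero_mul]), Finset.sum_eq_single j₀] at h1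
  · rwa [hsys j₀ ⟨by simp, hj₀.2⟩ j₀ hj₀.2, if_pos rfl, mul_one] at h1
  · intro j hj hne
    rw [hsys j ⟨by simp, (Finset.mem_Ico.1 hj).2⟩ j₀ hj₀.2, if_neg hne, mul_zero]
  · intro hj; exact absurd (Finset.mem_Ico.2 hj₀) hj

end QPolynomials

/-! ### Column heights of Ferrers diagrams and the Singleton-like bound. -/

section Ferrers

namespace FerrersDiagram

variable {m n : ℕ} (F : FerrersDiagram m n)

theorem γ_eq_card_filter (j : Fin n) :
    F.γ j = (Finset.univ.filter (fun a : Fin m => (a, j) ∈ F.cells)).card := by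
  symm
  refine Finset.card_bij (fun a _ => (a, j)) ?_ ?_ ?_
  · intro a ha
    simpa using ha
  · intro a _ b _ h
    simpa using h
  · rintro ⟨a, t⟩ h
    obtain ⟨h1, h2⟩ := Finset.mem_filter.1 h
    obtain rfl : t = j := Fin.ext h2
    exact ⟨a, by simpa using h1, rfl⟩

theorem mem_cells_iff (a : Fin m) (j : Fin n) : (a, j) ∈ F.cells ↔ (a : ℕ) < F.γ j := by
  rw [γ_eq_card_filter]
  constructor
  · intro h
    have : Finset.Iic a ⊆ Finset.univ.filter (fun a : Fin m => (a, j) ∈ F.cells) := by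
      intro b hb
      simpa using F.up_mem a b j h (Finset.mem_Iic.1 hb)
    have := Finset.card_le_card this
    rw [Fin.card_Iic] at this
    omega
  · intro h
    by_contra hn
    have : Finset.univ.filter (fun a : Fin m => (a, j) ∈ F.cells) ⊆ Finset.Iio a := by
      intro b hb
      rw [Finset.mem_Iio]
      by_contra hab
      exact hn (F.up_mem b a j (Finset.mem_filter.1 hb).2 (not_lt.1 hab))
    have := Finset.card_le_card this
    rw [Fin.card_Iio] at this
    omega

theorem γ_le (j : Fin n) : F.γ j ≤ m := by
  rw [γ_eq_card_filter]
  exact (Finset.card_le_univ _).trans (by simp)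

theorem γ_mono {i j : ℕ} (hij : i ≤ j) (hj : j < n) : F.γ i ≤ F.γ j := by
  have h1 := F.γ_eq_card_filter ⟨i, hij.trans_lt hj⟩
  have h2 := F.γ_eq_card_filter ⟨j, hj⟩
  simp only at h1 h2
  rw [h1, h2]
  refine Finset.card_le_card fun a ha => ?_
  have := (Finset.mem_filter.1 ha).2
  exact Finset.mem_filter.2 ⟨Finset.mem_univ _, F.right_mem _ _ _ this hij⟩

theorem γ_pos {j : ℕ} (hj : j < n) : 0 < F.γ j :=
  (F.mem_cells_iff ⟨0, F.m_pos⟩ ⟨j, hj⟩).1 (F.first_row _ _ rfl)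

theorem card_filter_lt_eq_sum (k : ℕ) :
    (F.cells.filter (fun c => (c.2 : ℕ) < k)).card = ∑ j ∈ Finset.range k, F.γ j := by
  rw [Finset.card_eq_sum_card_fiberwise (f := fun c => (c.2 : ℕ)) (t := Finset.range k)]
  · refine Finset.sum_congr rfl fun j hj => ?_
    rw [γ, Finset.filter_filter]
    congr 1
    ext c
    simp only [Finset.mem_filter, and_congr_right_iff, and_iff_right_iff_imp]
    rintro - rfl
    exact Finset.mem_range.1 hj
  · intro c hc
    simpa using (Finset.mem_filter.1 hc).2

theorem v_zero {δ : ℕ} (hδ : 0 < δ) (hδn : δ ≤ n) :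
    F.v δ 0 = ∑ j ∈ Finset.range (n - δ + 1), F.γ j := by
  rw [← card_filter_lt_eq_sum, v]
  congr 1
  ext c
  simp only [Finset.mem_filter, and_congr_right_iff]
  intro _
  omega

end FerrersDiagram

/-- A matrix supported in the first `i` rows and the last `s` columns has rank at most `i + s`. -/
theorem Matrix.rank_le_of_rows_of_cols {m n : ℕ} {K : Type*} [Field K]
    (A : Matrix (Fin m) (Fin n) K) (i s : ℕ)
    (h : ∀ (a : Fin m) (t : Fin n), i ≤ (a : ℕ) → (t : ℕ) + s < n → A a t = 0) :
    A.rank ≤ i + s := by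
  classical
  set R : Finset (Fin m → K) :=
    (Finset.univ.filter (fun a : Fin m => (a : ℕ) < i)).image (fun a => Pi.single a 1) with hR
  set T : Finset (Fin m → K) :=
    (Finset.univ.filter (fun t : Fin n => n ≤ (t : ℕ) + s)).image A.col with hT
  have hle : Submodule.span K (Set.range A.col) ≤ Submodule.span K ((R ∪ T : Finset _) : Set _) := by
    rw [Submodule.span_le]
    rintro _ ⟨t, rfl⟩
    by_cases ht : n ≤ (t : ℕ) + s
    · apply Submodule.subset_span
      rw [Finset.coe_union]
      right
      rw [hT]
      exact Finset.mem_coe.2 (Finset.mem_image_of_mem _ (by simpa using ht))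
    · have hcol : A.col t = ∑ a : Fin m, A a t • (Pi.single a 1 : Fin m → K) := by
        ext b
        simp [Finset.sum_apply, Pi.single_apply]
      rw [hcol]
      refine Submodule.sum_mem _ fun a _ => ?_
      by_cases ha : (a : ℕ) < i
      · refine Submodule.smul_mem _ _ (Submodule.subset_span ?_)
        rw [Finset.coe_union]
        left
        rw [hR]
        exact Finset.mem_coe.2 (Finset.mem_image_of_mem _ (by simpa using ha))
      · rw [h a t (not_lt.1 ha) (not_le.1 ht), zero_smul]
        exact zero_mem _
  rw [Matrix.rank_eq_finrank_span_cols]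
  have hRc : R.card ≤ i := by
    refine Finset.card_image_le.trans ?_
    rw [← Finset.card_range i]
    refine Finset.card_le_card_of_injOn (fun a => (a : ℕ)) ?_ (fun a _ b _ h => Fin.ext h)
    intro a ha
    simpa using ha
  have hTc : T.card ≤ s := by
    refine Finset.card_image_le.trans ?_
    rw [← Finset.card_range s]
    refine Finset.card_le_card_of_injOn (fun t => n - 1 - (t : ℕ)) ?_ ?_
    · intro t ht
      have : n ≤ (t : ℕ) + s := by simpa using ht
      simp only [Finset.coe_range, Set.mem_Iio]
      omega
    · intro t _ t' _ h
      simp only at h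
      omega
  calc _ ≤ _ := Submodule.finrank_mono hle
    _ ≤ (R ∪ T).card := finrank_span_finset_le_card _
    _ ≤ R.card + T.card := Finset.card_union_le _ _
    _ ≤ i + s := by omega

/-- The Singleton-like bound for Ferrers diagram rank-metric codes. -/
theorem IsFDRMCode.le_v {m n : ℕ} {F : FerrersDiagram m n} {K : Type*} [Field K]
    {C : Submodule K (Matrix (Fin m) (Fin n) K)} {k δ : ℕ} (hC : IsFDRMCode F C k δ)
    {i : ℕ} (hi : i < δ) : k ≤ F.v δ i := by
  obtain ⟨⟨hk, -, hmin⟩, hsupp⟩ := hC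
  let V := F.cells.filter (fun c => i ≤ (c.1 : ℕ) ∧ (c.2 : ℕ) + (δ - 1 - i) < n)
  let p : C →ₗ[K] (V → K) :=
    { toFun := fun A c => (A : Matrix _ _ K) c.1.1 c.1.2
      map_add' := fun A B => rfl
      map_smul' := fun a A => rfl }
  -- A codeword vanishing on the cells counted by `v` lives in `i` rows and `δ - 1 - i` columns, so
  -- its rank is below `δ` and it is zero.
  have hp : Function.Injective p := by
    rw [← LinearMap.ker_eq_bot, LinearMap.ker_eq_bot']
    rintro ⟨A, hA⟩ h0
    by_contra hne
    have hA0 : A ≠ 0 := fun h => hne (Subtype.ext h)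
    have h1 : δ ≤ A.rank := by
      have := hmin ⟨A, hA, 0, zero_mem _, hA0, rfl⟩
      rwa [rankDist, sub_zero] at this
    have h2 : A.rank ≤ i + (δ - 1 - i) := by
      refine A.rank_le_of_rows_of_cols _ _ fun a t ha ht => ?_
      by_cases hat : (a, t) ∈ F.cells
      · exact congrFun h0 ⟨(a, t), Finset.mem_filter.2 ⟨hat, ha, ht⟩⟩
      · exact hsupp A hA a t hat
    omega
  have := LinearMap.finrank_le_finrank_of_injective hp
  rw [hk, Module.finrank_fintype_fun_eq_card, Fintype.card_coe] at this
  exact this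

end Ferrers

/-! ### The encoder and the rank of its nonzero codewords. -/

section Encoder

variable {K L : Type*} [Field K] [Field L] [Algebra K L] {μ : ℕ}

/-- The element of `L` whose coordinates are the first `μ` entries of the column `j` of `w`. -/
noncomputable def columnElt (b : Module.Basis (Fin μ) K L) (w : ℕ → ℕ → K) (j : ℕ) : L :=
  ∑ p : Fin μ, w p j • b p

/-- The encoding of the columns of `w` by the first `k` rows of `c`. -/
noncomputable def encodeElt (b : Module.Basis (Fin μ) K L) (c : ℕ → ℕ → L) (k : ℕ)
    (w : ℕ → ℕ → K) (t : ℕ) : L :=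
  ∑ j ∈ Finset.range k, columnElt b w j * c j t

/-- The part below the first `μ` rows: the column `l` is the concatenation, from top to bottom, of
the columns `l, l - 1, …, 0` of `w`, whose lengths are given by `γ`. -/
noncomputable def stackEntry (γ : ℕ → ℕ) (w : ℕ → ℕ → K) (e l : ℕ) : K :=
  ∑ j ∈ Finset.range (l + 1),
    if ∑ s ∈ Finset.range (l + 1), γ s ≤ e + ∑ s ∈ Finset.range (j + 1), γ s then
      w (e + ∑ s ∈ Finset.range (j + 1), γ s - ∑ s ∈ Finset.range (l + 1), γ s) j else 0

/-- The entries of the codeword of the message `w`. -/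
noncomputable def codeEntry (b : Module.Basis (Fin μ) K L) (c : ℕ → ℕ → L) (γ : ℕ → ℕ) (k : ℕ)
    (w : ℕ → ℕ → K) (a t : ℕ) : K :=
  if h : a < μ then b.repr (encodeElt b c k w t) ⟨a, h⟩
  else if t < μ then 0 else stackEntry γ w (a - μ) (t - μ)

theorem codeEntry_add (b : Module.Basis (Fin μ) K L) (c : ℕ → ℕ → L) (γ : ℕ → ℕ) (k : ℕ)
    (w w' : ℕ → ℕ → K) (a t : ℕ) :
    codeEntry b c γ k (w + w') a t = codeEntry b c γ k w a t + codeEntry b c γ k w' a t := by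
  unfold codeEntry
  split_ifs
  · simp [encodeElt, columnElt, add_smul, Finset.sum_add_distrib, add_mul]
  · simp
  · rw [stackEntry, stackEntry, stackEntry, ← Finset.sum_add_distrib]
    refine Finset.sum_congr rfl fun j _ => ?_
    split_ifs <;> simp

theorem codeEntry_smul (b : Module.Basis (Fin μ) K L) (c : ℕ → ℕ → L) (γ : ℕ → ℕ) (k : ℕ)
    (x : K) (w : ℕ → ℕ → K) (a t : ℕ) :
    codeEntry b c γ k (x • w) a t = x * codeEntry b c γ k w a t := by
  have hcol : ∀ j, columnElt b (x • w) j = x • columnElt b w j := fun j => by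
    simp [columnElt, Finset.smul_sum, mul_smul]
  have henc : encodeElt b c k (x • w) t = x • encodeElt b c k w t := by
    simp only [encodeElt, hcol, smul_mul_assoc, Finset.smul_sum]
  unfold codeEntry
  split_ifs
  · rw [henc]
    simp
  · simp
  · rw [stackEntry, stackEntry, Finset.mul_sum]
    refine Finset.sum_congr rfl fun j _ => ?_
    split_ifs <;> simp

theorem columnElt_repr (b : Module.Basis (Fin μ) K L) (w : ℕ → ℕ → K) (j : ℕ) (p : Fin μ) :
    b.repr (columnElt b w j) p = w p j := by
  simp [columnElt, Finsupp.single_apply]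

theorem encodeElt_of_lt (b : Module.Basis (Fin μ) K L) {c : ℕ → ℕ → L} {k : ℕ}
    (hc : ∀ j < k, ∀ t < k, c j t = if j = t then 1 else 0) (w : ℕ → ℕ → K) {t : ℕ} (ht : t < k) :
    encodeElt b c k w t = columnElt b w t := by
  rw [encodeElt, Finset.sum_eq_single t]
  · rw [hc t ht t ht, if_pos rfl, mul_one]
  · intro j hj hne
    rw [hc j (Finset.mem_range.1 hj) t ht, if_neg hne, mul_zero]
  · intro h
    exact absurd (Finset.mem_range.2 ht) h

theorem codeEntry_of_lt_of_lt (b : Module.Basis (Fin μ) K L) {c : ℕ → ℕ → L} {k : ℕ} (γ : ℕ → ℕ)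
    (hc : ∀ j < k, ∀ t < k, c j t = if j = t then 1 else 0) (w : ℕ → ℕ → K) {a t : ℕ}
    (ha : a < μ) (ht : t < k) : codeEntry b c γ k w a t = w a t := by
  rw [codeEntry, dif_pos ha, encodeElt_of_lt b hc w ht, columnElt_repr]

theorem le_sum_range_succ (γ : ℕ → ℕ) (j : ℕ) : γ j ≤ ∑ s ∈ Finset.range (j + 1), γ s := by
  rw [Finset.sum_range_succ]
  omega

theorem sum_range_mono (γ : ℕ → ℕ) {i j : ℕ} (h : i ≤ j) :
    ∑ s ∈ Finset.range i, γ s ≤ ∑ s ∈ Finset.range j, γ s :=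
  Finset.sum_le_sum_of_subset (Finset.range_mono h)

theorem stackEntry_eq_zero {γ : ℕ → ℕ} {w : ℕ → ℕ → K} (hw : ∀ a j, γ j ≤ a → w a j = 0) {e l : ℕ}
    (h : ∑ s ∈ Finset.range (l + 1), γ s ≤ e) : stackEntry γ w e l = 0 := by
  refine Finset.sum_eq_zero fun j _ => ?_
  split_ifs
  · refine hw _ _ ?_
    have := le_sum_range_succ γ j
    omega
  · rfl

/-- If the columns of `w` before the column `i` vanish, then in the row where the column `l` of the
stacked part contains the last nonzero entry `w p i`, all columns before `l` vanish. -/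
theorem stackEntry_pivot {γ : ℕ → ℕ} {w : ℕ → ℕ → K} (hw : ∀ a j, γ j ≤ a → w a j = 0)
    {i p l l' : ℕ} (hzero : ∀ j < i, ∀ a, w a j = 0) (hlast : ∀ a, p < a → w a i = 0)
    (hγ : ∀ s ≤ l, 0 < γ s) (hil : i ≤ l) (hl : l' ≤ l) :
    stackEntry γ w (∑ s ∈ Finset.range (l + 1), γ s - ∑ s ∈ Finset.range (i + 1), γ s + p) l' =
      if l' = l then w p i else 0 := by
  have hSil := sum_range_mono γ (Nat.succ_le_succ hil)
  have hne : ∀ j ≤ l', j ≠ i → (if ∑ s ∈ Finset.range (l' + 1), γ s ≤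
      ∑ s ∈ Finset.range (l + 1), γ s - ∑ s ∈ Finset.range (i + 1), γ s + p +
        ∑ s ∈ Finset.range (j + 1), γ s then
      w (∑ s ∈ Finset.range (l + 1), γ s - ∑ s ∈ Finset.range (i + 1), γ s + p +
        ∑ s ∈ Finset.range (j + 1), γ s - ∑ s ∈ Finset.range (l' + 1), γ s) j else 0) = 0 := by
    intro j hj hji
    rcases Nat.lt_or_gt_of_ne hji with h | h
    · rw [hzero j h, ite_self]
    -- For `j > i` the block of column `j` ends above this row.
    · refine ite_eq_right_iff.2 fun _ => hw _ _ ?_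
      have h1 := sum_range_mono γ (show i + 1 ≤ j by omega)
      have h2 := sum_range_mono γ (Nat.succ_le_succ hl)
      have h3 := Finset.sum_range_succ γ j
      simp only [Nat.succ_eq_add_one] at *
      omega
  rw [stackEntry]
  by_cases hil' : i ≤ l'
  · rw [Finset.sum_eq_single i (fun j hj => hne j (by have := Finset.mem_range.1 hj; omega))
      (fun h => absurd (Finset.mem_range.2 (by omega)) h)]
    have h2 := sum_range_mono γ (Nat.succ_le_succ hl)
    simp only [Nat.succ_eq_add_one] at *
    rw [if_pos (by omega)]
    split_ifs with h
    · subst h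
      congr 1
      omega
    -- In a column `l' < l` the block of column `i` starts at least `γ l > 0` rows higher, so this
    -- row falls after its last nonzero entry.
    · refine hlast _ ?_
      have h3 := sum_range_mono γ (show l' + 1 ≤ l by omega)
      have h4 := Finset.sum_range_succ γ l
      have h5 := hγ l le_rfl
      omega
  · rw [if_neg (by omega)]
    exact Finset.sum_eq_zero fun j hj => hne j (by have := Finset.mem_range.1 hj; omega)
      (by have := Finset.mem_range.1 hj; omega)

/-- The first `k` columns reproduce the message on top; the other columns have room for all `μ` top
rows, and the last `r` also for their stacks. -/
theorem codeEntry_eq_zero_of_not_mem {m n k : ℕ} (F : FerrersDiagram m n)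
    (b : Module.Basis (Fin μ) K L) {c : ℕ → ℕ → L}
    (hc : ∀ j < k, ∀ t < k, c j t = if j = t then 1 else 0)
    {w : ℕ → ℕ → K} (hw : ∀ a j, F.γ j ≤ a → w a j = 0)
    (hγ : ∀ t, k ≤ t → t < n → μ ≤ F.γ t)
    (hγ' : ∀ l, μ + l < n → μ + ∑ s ∈ Finset.range (l + 1), F.γ s ≤ F.γ (μ + l))
    (a : Fin m) (t : Fin n) (hat : (a, t) ∉ F.cells) : codeEntry b c F.γ k w a t = 0 := by
  rw [F.mem_cells_iff, not_lt] at hat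
  by_cases ha : (a : ℕ) < μ
  · have htk : (t : ℕ) < k := by
      by_contra h
      have := hγ t (not_lt.1 h) t.2
      omega
    rw [codeEntry_of_lt_of_lt b _ hc w ha htk]
    exact hw _ _ hat
  · rw [codeEntry, dif_neg ha]
    split_ifs with ht
    · rfl
    · have := hγ' (t - μ) (by omega)
      rw [show μ + ((t : ℕ) - μ) = t by omega] at this
      exact stackEntry_eq_zero hw (by omega)

theorem finrank_ker_codeEntry_lt {m n k r : ℕ} (hμn : μ + r = n) (hrk : r < k) (hkμ : k ≤ μ)
    (hμm : μ ≤ m) (b : Module.Basis (Fin μ) K L) {c : ℕ → ℕ → L}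
    (hc : ∀ j < k, ∀ t < k, c j t = if j = t then 1 else 0)
    (hwin : ∀ l ≤ r, ∃ h : ℕ → L, LinearIndepOn K h (Set.Ico l (l + μ)) ∧
      ∀ u : ℕ → L, (∃ j ∈ Set.Ico l k, u j ≠ 0) → ∃ f : L →ₗ[K] L,
        Module.finrank K (LinearMap.ker f) < k - l ∧
        ∀ t ∈ Set.Ico l (l + μ), ∑ j ∈ Finset.Ico l k, u j * c j t = f (h t))
    {γ : ℕ → ℕ} (hγpos : ∀ s < n, 0 < γ s) (hγμ : ∀ j < k, γ j ≤ μ)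
    (hγm : ∀ l < r, μ + ∑ s ∈ Finset.range (l + 1), γ s ≤ m)
    {w : ℕ → ℕ → K} (hw : ∀ a j, γ j ≤ a → w a j = 0) (hne : ∃ j < k, ∃ a, w a j ≠ 0) :
    Module.finrank K (LinearMap.ker
      (Matrix.of fun (a : Fin m) (t : Fin n) => codeEntry b c γ k w a t).mulVecLin) < k := by
  classical
  have : FiniteDimensional K L := b.finiteDimensional_of_finite
  -- the first nonzero column, capped at `r`
  obtain ⟨i, hir, hzero, hpiv, j₀, hj₀, hj₀w⟩ : ∃ i ≤ r, (∀ j < i, ∀ a, w a j = 0) ∧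
      (i < r → ∃ a, w a i ≠ 0) ∧ ∃ j ∈ Set.Ico i k, ∃ a, w a j ≠ 0 := by
    have hspec := Nat.find_spec hne
    have hmin : ∀ j < Nat.find hne, ∀ a, w a j = 0 := by
      intro j hj a
      by_contra h
      exact Nat.find_min hne hj ⟨hj.trans hspec.1, a, h⟩
    -- Windows exist only up to `r`. The window of `r` already reaches column `n - 1`, so in the
    -- capped case no pivots are needed.
    refine ⟨min (Nat.find hne) r, min_le_right _ _, fun j hj => hmin j (by omega), fun h => ?_,
      Nat.find hne, ⟨min_le_left _ _, hspec.1⟩, hspec.2⟩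
    rw [min_eq_left (by omega)]
    exact hspec.2
  obtain ⟨h, hh, hf⟩ := hwin i hir
  have hcol0 : ∀ j < i, columnElt b w j = 0 := fun j hj => by
    simp [columnElt, hzero j hj]
  have hcolne : columnElt b w j₀ ≠ 0 := by
    intro h0
    obtain ⟨a, ha⟩ := hj₀w
    have haμ : a < μ := by
      by_contra hn
      exact ha (hw a j₀ ((hγμ j₀ hj₀.2).trans (not_lt.1 hn)))
    have := columnElt_repr b w j₀ ⟨a, haμ⟩
    rw [h0, map_zero] at this
    exact ha this.symm
  obtain ⟨f, hfker, hfeval⟩ := hf (columnElt b w) ⟨j₀, hj₀, hcolne⟩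
  have hencf : ∀ t ∈ Set.Ico i (i + μ), encodeElt b c k w t = f (h t) := by
    intro t ht
    rw [← hfeval t ht, encodeElt, Finset.range_eq_Ico,
      ← Finset.sum_Ico_consecutive _ (Nat.zero_le i) (by omega : i ≤ k)]
    rw [Finset.sum_eq_zero (s := Finset.Ico 0 i) (fun j hj => by
      rw [hcol0 j (Finset.mem_Ico.1 hj).2, zero_mul]), zero_add]
  set M : Matrix (Fin m) (Fin n) K := Matrix.of fun a t => codeEntry b c γ k w a t with hM
  let X : (Fin n → K) → ℕ → K := fun x t => if ht : t < n then x ⟨t, ht⟩ else 0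
  have hXker : ∀ x ∈ LinearMap.ker M.mulVecLin, ∀ a < m,
      ∑ t ∈ Finset.range n, codeEntry b c γ k w a t * X x t = 0 := by
    intro x hx a ha
    have := congrFun (LinearMap.mem_ker.1 hx) ⟨a, ha⟩
    rw [Finset.sum_range]
    simpa [Matrix.mulVec, dotProduct, hM, X] using this
  -- the stacked part kills the last coordinates
  have htail : ∀ x ∈ LinearMap.ker M.mulVecLin, ∀ l, i ≤ l → l < r → X x (μ + l) = 0 := by
    intro x hx l hil hlr
    obtain ⟨a₁, ha₁⟩ := hpiv (by omega)
    obtain ⟨p, hp, hlast⟩ : ∃ p, w p i ≠ 0 ∧ ∀ a, p < a → w a i = 0 := by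
      have hP : ∃ p ≤ γ i, w p i ≠ 0 := ⟨a₁, by
        by_contra hn
        exact ha₁ (hw _ _ (not_le.1 hn).le), ha₁⟩
      have hspec := Nat.findGreatest_spec (P := fun p => w p i ≠ 0) hP.choose_spec.1
        hP.choose_spec.2
      refine ⟨_, hspec, fun a ha => ?_⟩
      by_contra hn
      have haγ : a ≤ γ i := by
        by_contra hn'
        exact hn (hw _ _ (not_le.1 hn').le)
      exact Nat.findGreatest_is_greatest ha haγ hn
    have hpγ : p < γ i := by
      by_contra hn
      exact hp (hw _ _ (not_lt.1 hn))
    -- Back substitution from the rightmost column: in the pivot row of `l` the entries left of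
    -- column `μ + l` vanish, and the coordinates to its right are already zero.
    induction hd : r - l using Nat.strong_induction_on generalizing l with
    | _ d ih =>
      have hS := sum_range_mono γ (Nat.succ_le_succ hil)
      have hSi := le_sum_range_succ γ i
      have hSm := hγm l hlr
      simp only [Nat.succ_eq_add_one] at hS
      have hrow := hXker x hx
        (μ + (∑ s ∈ Finset.range (l + 1), γ s - ∑ s ∈ Finset.range (i + 1), γ s + p)) (by omega)
      rw [Finset.sum_eq_single (μ + l)] at hrow
      · rw [codeEntry, dif_neg (by omega), if_neg (by omega), Nat.add_sub_cancel_left,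
          Nat.add_sub_cancel_left, stackEntry_pivot hw hzero hlast
            (fun s hs => hγpos s (by omega)) hil le_rfl, if_pos rfl] at hrow
        exact (mul_eq_zero.1 hrow).resolve_left hp
      · intro t ht htl
        have ht := Finset.mem_range.1 ht
        rcases Nat.lt_or_gt_of_ne htl with hlt | hgt
        · rw [codeEntry, dif_neg (by omega)]
          split_ifs with htμ
          · rw [zero_mul]
          · rw [Nat.add_sub_cancel_left, stackEntry_pivot hw hzero hlast
              (fun s hs => hγpos s (by omega)) hil (by omega), if_neg (by omega), zero_mul]
        · have := ih (r - (t - μ)) (by omega) (t - μ) (by omega) (by omega) rfl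
          rw [show μ + (t - μ) = t by omega] at this
          rw [this, mul_zero]
      · intro hn
        exact absurd (Finset.mem_range.2 (by omega)) hn
  have htail' : ∀ x ∈ LinearMap.ker M.mulVecLin, ∀ t, i + μ ≤ t → X x t = 0 := by
    intro x hx t ht
    by_cases htn : t < n
    · have := htail x hx (t - μ) (by omega) (by omega)
      rwa [show μ + (t - μ) = t by omega] at this
    · exact dif_neg htn
  have hfzero : ∀ x ∈ LinearMap.ker M.mulVecLin,
      f (∑ t ∈ Finset.Ico i (i + μ), X x t • h t) = 0 := by
    intro x hx
    have hsum : f (∑ t ∈ Finset.Ico i (i + μ), X x t • h t) =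
        ∑ t ∈ Finset.range n, X x t • encodeElt b c k w t := by
      rw [map_sum]
      simp only [map_smul]
      have hsub : Finset.Ico i (i + μ) ⊆ Finset.range n := fun t ht => by
        have := (Finset.mem_Ico.1 ht).2
        exact Finset.mem_range.2 (by omega)
      rw [← Finset.sum_subset hsub]
      · refine Finset.sum_congr rfl fun t ht => ?_
        rw [hencf t (by simpa using ht)]
      · intro t _ ht
        by_cases hti : t < i
        · rw [encodeElt_of_lt b hc w (by omega), hcol0 t hti, smul_zero]
        · rw [htail' x hx t (by
            by_contra hn
            exact ht (Finset.mem_Ico.2 ⟨by omega, by omega⟩)), zero_smul]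
    rw [hsum]
    apply b.repr.injective
    ext a
    have := hXker x hx a (a.2.trans_le hμm)
    simp only [codeEntry, a.2, dif_pos, Fin.eta] at this
    simp only [map_sum, map_smul, map_zero, Finsupp.coe_finsetSum, Finset.sum_apply,
      Finsupp.smul_apply, smul_eq_mul, Finsupp.coe_zero, Pi.zero_apply]
    rw [← this]
    exact Finset.sum_congr rfl fun t _ => mul_comm _ _
  let ev : (Fin n → K) →ₗ[K] L :=
    { toFun := fun x => ∑ t ∈ Finset.Ico i (i + μ), X x t • h t
      map_add' := fun x y => by
        rw [← Finset.sum_add_distrib]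
        refine Finset.sum_congr rfl fun t _ => ?_
        rw [← add_smul]
        congr 1
        simp only [X]
        split_ifs <;> simp
      map_smul' := fun a x => by
        rw [RingHom.id_apply, Finset.smul_sum]
        refine Finset.sum_congr rfl fun t _ => ?_
        rw [smul_smul]
        congr 1
        simp only [X]
        split_ifs <;> simp }
  -- A kernel vector is determined by its first `i` coordinates and by its combination of the points
  -- `h t`, which are independent; its coordinates past the window are zero.
  let ψ : LinearMap.ker M.mulVecLin →ₗ[K] (Fin i → K) × LinearMap.ker f :=
    LinearMap.prod
      ((LinearMap.funLeft K K (fun s : Fin i => (⟨s, by omega⟩ : Fin n))) ∘ₗ Submodule.subtype _)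
      (LinearMap.codRestrict _ (ev ∘ₗ Submodule.subtype _) fun x => hfzero x x.2)
  have hψ : Function.Injective ψ := by
    rw [← LinearMap.ker_eq_bot, LinearMap.ker_eq_bot']
    rintro ⟨x, hx⟩ hx0
    have h1 : ∀ t (ht : t < i), X x t = 0 := fun t ht => by
      have := congrFun (congrArg Prod.fst hx0) ⟨t, ht⟩
      simp only [X]
      rw [dif_pos (by omega)]
      exact this
    have h2 : ∑ t ∈ Finset.Ico i (i + μ), X x t • h t = 0 :=
      congrArg Subtype.val (congrArg Prod.snd hx0)
    rw [← Finset.coe_Ico] at hh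
    have h3 := linearIndepOn_finset_iff.1 hh (X x) h2
    apply Subtype.ext
    funext t
    have h4 : X x t = 0 := by
      by_cases ht : (t : ℕ) < i
      · exact h1 t ht
      · by_cases ht' : i + μ ≤ t
        · exact htail' x hx t ht'
        · exact h3 t (Finset.mem_Ico.2 ⟨by omega, by omega⟩)
    simpa [X] using h4
  have hle := LinearMap.finrank_le_finrank_of_injective hψ
  rw [Module.finrank_prod, Module.finrank_fin_fun] at hle
  omega

end Encoder

/-! ### Assembling the optimal code. -/

section Construction

/-- The message with prescribed entries at the dots in the first `k` columns, and zero elsewhere. -/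
def FerrersDiagram.message {m n : ℕ} (F : FerrersDiagram m n) {K : Type*} [Field K] {k : ℕ}
    (x : F.cells.filter (fun c => (c.2 : ℕ) < k) → K) (a j : ℕ) : K :=
  if h : ∃ (ha : a < m) (hj : j < n),
      ((⟨a, ha⟩, ⟨j, hj⟩) : Fin m × Fin n) ∈ F.cells.filter (fun c => (c.2 : ℕ) < k) then
    x ⟨(⟨a, h.1⟩, ⟨j, h.2.1⟩), h.2.2⟩ else 0

theorem exists_finiteDimensional_field_extension (K : Type*) [Field K] [Finite K] {μ : ℕ}
    (hμ : 0 < μ) : ∃ (L : Type) (_ : Field L) (_ : Algebra K L),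
      FiniteDimensional K L ∧ Module.finrank K L = μ := by
  obtain ⟨p, hp⟩ := CharP.exists K
  have : Fact p.Prime := ⟨CharP.char_is_prime K p⟩
  have : NeZero μ := ⟨hμ.ne'⟩
  exact ⟨FiniteField.Extension K p μ, inferInstance, inferInstance, inferInstance,
    FiniteField.finrank_extension K p μ⟩

theorem FerrersDiagram.exists_isOptimalFDRMCode {m n r k μ : ℕ} (hr : 0 < r) (hrk : r < k)
    (hkμ : k ≤ μ) (hμn : μ + r = n) (F : FerrersDiagram m n)
    (h1 : F.γ (μ - 1) ≤ μ) (h2 : ∀ i < r, μ + ∑ j ∈ Finset.range (i + 1), F.γ j ≤ F.γ (μ + i))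
    (h3 : ∀ i, k ≤ i → i < n → μ ≤ F.γ i) (K : Type*) [Field K] [Finite K] :
    ∃ C : Submodule K (Matrix (Fin m) (Fin n) K),
      IsOptimalFDRMCode F C (∑ i ∈ Finset.range k, F.γ i) (n + 1 - k) := by
  classical
  obtain ⟨L, _, _, _, hL⟩ := exists_finiteDimensional_field_extension K (μ := μ) (by omega)
  obtain ⟨c, hc, hwin⟩ := exists_systematic_windows K hL (by omega) hrk.le hkμ
  let b := Module.finBasisOfFinrankEq K L hL
  let D := F.cells.filter (fun c => (c.2 : ℕ) < k)
  have hγm : ∀ t < n, F.γ t ≤ m := fun t ht => F.γ_le ⟨t, ht⟩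
  have hγμ : ∀ j < k, F.γ j ≤ μ := fun j hj => (F.γ_mono (by omega) (by omega)).trans h1
  have hμm : μ ≤ m := (h3 (n - 1) (by omega) (by omega)).trans (hγm _ (by omega))
  have hγpos : ∀ s < n, 0 < F.γ s := fun s hs => F.γ_pos hs
  have hmsg : ∀ (x : D → K) (d : D), F.message x d.1.1 d.1.2 = x d := by
    intro x d
    rw [FerrersDiagram.message, dif_pos ⟨d.1.1.2, d.1.2.2, d.2⟩]
  have hsupp : ∀ (x : D → K) (a j : ℕ), F.γ j ≤ a → F.message x a j = 0 := by
    intro x a j haj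
    refine dif_neg ?_
    rintro ⟨ha, hj, h⟩
    have := (F.mem_cells_iff _ _).1 (Finset.mem_filter.1 h).1
    simp only at this
    omega
  let enc : (D → K) →ₗ[K] Matrix (Fin m) (Fin n) K :=
    { toFun := fun x => Matrix.of fun a t => codeEntry b c F.γ k (F.message x) a t
      map_add' := fun x y => by
        ext a t
        have : F.message (x + y) = F.message x + F.message y := by
          funext a j
          simp only [FerrersDiagram.message, Pi.add_apply]
          split_ifs <;> simp
        simp only [this, Matrix.of_apply, Matrix.add_apply, codeEntry_add]
      map_smul' := fun s x => by
        ext a t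
        have : F.message (s • x) = s • F.message x := by
          funext a j
          simp only [FerrersDiagram.message, Pi.smul_apply]
          split_ifs <;> simp
        simp only [this, Matrix.of_apply, Matrix.smul_apply, codeEntry_smul, RingHom.id_apply,
          smul_eq_mul] }
  have henc : ∀ (x : D → K) (d : D), enc x d.1.1 d.1.2 = x d := by
    intro x d
    have hd := Finset.mem_filter.1 d.2
    have h4 := (F.mem_cells_iff _ _).1 hd.1
    rw [← hmsg x d]
    exact codeEntry_of_lt_of_lt b _ hc _ (h4.trans_le (hγμ _ hd.2)) hd.2
  have hinj : Function.Injective enc := by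
    intro x y hxy
    funext d
    rw [← henc x d, ← henc y d, hxy]
  have hrank : ∀ x : D → K, x ≠ 0 → n + 1 - k ≤ (enc x).rank := by
    intro x hx
    obtain ⟨d, hd⟩ := Function.ne_iff.1 hx
    have hlt := finrank_ker_codeEntry_lt hμn hrk hkμ hμm b hc hwin hγpos hγμ
      (fun l hl => (h2 l hl).trans (hγm _ (by omega))) (hsupp x)
      ⟨d.1.2, (Finset.mem_filter.1 d.2).2, d.1.1, by rw [hmsg]; exact hd⟩
    have hrn := LinearMap.finrank_range_add_finrank_ker (enc x).mulVecLin
    rw [Module.finrank_fin_fun] at hrn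
    change (enc x).rank + _ = n at hrn
    change Module.finrank K (LinearMap.ker (enc x).mulVecLin) < k at hlt
    omega
  have hcode : IsFDRMCode F (LinearMap.range enc) (∑ i ∈ Finset.range k, F.γ i) (n + 1 - k) := by
    refine ⟨⟨?_, ?_, ?_⟩, ?_⟩
    · rw [LinearMap.finrank_range_of_inj hinj, Module.finrank_fintype_fun_eq_card,
        Fintype.card_coe]
      exact F.card_filter_lt_eq_sum k
    -- Distance exactly `δ`: a message supported in column `k - 1` gives a codeword supported in the
    -- last `n + 1 - k` columns.
    · have hd₀ : ((⟨0, F.m_pos⟩, ⟨k - 1, by omega⟩) : Fin m × Fin n) ∈ D :=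
        Finset.mem_filter.2 ⟨F.first_row _ _ rfl, by simp only; omega⟩
      set x : D → K := Pi.single ⟨_, hd₀⟩ 1 with hx
      have hx0 : x ≠ 0 := by simp [hx]
      have hxcol : ∀ a j, j + 1 < k → F.message x a j = 0 := by
        intro a j hj
        rw [FerrersDiagram.message]
        split_ifs with h
        · refine Pi.single_eq_of_ne (fun he => ?_) _
          have := congrArg (fun d : D => (d.1.2 : ℕ)) he
          simp only at this
          omega
        · rfl
      refine ⟨enc x, ⟨x, rfl⟩, 0, zero_mem _, fun h => hx0 (hinj (h.trans (map_zero enc).symm)), ?_⟩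
      rw [rankDist, sub_zero]
      refine le_antisymm ?_ (hrank x hx0)
      have := (enc x).rank_le_of_rows_of_cols 0 (n + 1 - k) fun a t _ ht => ?_
      · omega
      · change codeEntry b c F.γ k (F.message x) a t = 0
        by_cases ha : (a : ℕ) < μ
        · rw [codeEntry_of_lt_of_lt b _ hc _ ha (by omega), hxcol _ _ (by omega)]
        · rw [codeEntry, dif_neg ha, if_pos (by omega)]
    · rintro _ ⟨_, ⟨x, rfl⟩, _, ⟨y, rfl⟩, hne, rfl⟩
      rw [rankDist, ← map_sub]
      exact hrank _ (sub_ne_zero.2 fun h => hne (congrArg enc h))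
    · rintro _ ⟨x, rfl⟩ a t hat
      exact codeEntry_eq_zero_of_not_mem F b hc (hsupp x) h3 (fun l hl => h2 l (by omega)) a t hat
  refine ⟨LinearMap.range enc, hcode, ⟨0, by omega, ?_⟩, ?_⟩
  · rw [F.v_zero (by omega) (by omega), show n - (n + 1 - k) + 1 = k by omega]
  -- The other `v i` need no computation: the code just built obeys the Singleton-like bound.
  · rintro _ ⟨i, hi, rfl⟩
    exact hcode.le_v hi

end Construction

theorem theorem3p11 (m n r δ : ℕ) (hr : 0 < r) (hrδ : r + 1 ≤ δ) (hδ : δ ≤ n - r)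
    (F : FerrersDiagram m n)
    (h1 : F.γ (n - r - 1) ≤ n - r)
    (h2 : ∀ i < r, n - r + ∑ j ∈ Finset.range (i + 1), F.γ j ≤ F.γ (n - r + i))
    (h3 : ∀ i, n - δ + 1 ≤ i → i ≤ n - 1 → n - r ≤ F.γ i)
    (q : ℕ) (hq : IsPrimePow q) (K : Type*) [Field K] [Finite K] (hK : Nat.card K = q) :
    ∃ C : Submodule K (Matrix (Fin m) (Fin n) K),
      IsOptimalFDRMCode F C (∑ i ∈ Finset.range (n - δ + 1), F.γ i) δ := by
  have h := F.exists_isOptimalFDRMCode hr (k := n - δ + 1) (μ := n - r) (by omega) (by omega)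
    (by omega) h1 h2 (fun i hi hin => h3 i hi (by omega)) K
  rwa [show n + 1 - (n - δ + 1) = δ by omega] at h
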